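/- Let $p$ be a prime, let $m,s\ge 1$ be integers, let $\alpha_0\in\mathbb F_{p^m}$ be nonzero and put $\alpha=\alpha_0^{p^s}$. Let $R=\mathbb F_{p^m}+u\,\mathbb F_{p^m}$ with $u^2=0$, $\mathcal F=\mathbb F_{p^m}[x]/\langle x^{2p^s}-\alpha\rangle$ and $\mathcal R=R[x]/\langle x^{2p^s}-\alpha\rangle$. Identify a vector $(c_0,\dots,c_{2p^s-1})\in R^{2p^s}$ with the class of $c_0+c_1x+\cdots+c_{2p^s-1}x^{2p^s-1}$ in $\mathcal R$, so that ideals of $\mathcal R$ are linear codes of length $2p^s$ over $R$. A linear code $\mathcal C\subseteq R^{n}$ is $\alpha$-constacyclic if the shift $(x_0,\dots,x_{n-1})\mapsto(\alpha x_{n-1},x_0,\dots,x_{n-2})$ maps it onto itself. The symbol-pair distance of $x,y\in R^n$ is the number of indices $i$ modulo $n$ with $(x_i,x_{i+1})\ne(y_i,y_{i+1})$, and $d_{\mathrm{sp}}(\mathcal C)$ is its minimum over distinct codewords; a code $\mathcal C\subseteq R^n$ with at least two codewords is an MDS symbol-pair code if $|\mathcal C|=|R|^{\,n-d_{\mathrm{sp}}(\mathcal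 C)+2}$. Let $b(x)\in\mathbb F_{p^m}[x]$ be a polynomial whose class in $\mathcal F$ is either zero or a unit. Then each of the following ideals $\mathcal D$ of $\mathcal R$ is an MDS symbol-pair $\alpha$-constacyclic code of length $2p^s$ over $R$: (i) $\mathcal D=\langle (x^2-\alpha_0)+u\,b(x)\rangle$; (ii) $\mathcal D=\langle (x^2-\alpha_0)^{p^s-1}+u\,(x^2-\alpha_0)^{p^s-2}b(x)\rangle$; (iii) if $s=1$, $\mathcal D=\langle (x^2-\alpha_0)^{j}+u\,(x^2-\alpha_0)^{k}b(x)\rangle$ for all integers $j,k$ with $1\le j\le p-1$ and $\max\{0,2j-p\}\le k<j$. -/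

import Mathlib

open Polynomial

/-- The symbol-pair distance of two vectors of length `n`: the number of `i` such that
`(x_i, x_{i+1}) ≠ (y_i, y_{i+1})`, indices modulo `n` (`finRotate n` sends `i` to `i + 1` and the
last index to `0`). -/
noncomputable def pairDist {A : Type*} {n : ℕ} (x y : Fin n → A) : ℕ :=
  Set.ncard {i : Fin n | (x i, x (finRotate n i)) ≠ (y i, y (finRotate n i))}

/-- The (minimum) symbol-pair distance of a code; the set of distances is non-empty as soon as the
code has two different words. -/
noncomputable def minPairDist {A : Type*} {n : ℕ} (C : Set (Fin n → A)) : ℕ :=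
  sInf {d : ℕ | ∃ x ∈ C, ∃ y ∈ C, x ≠ y ∧ pairDist x y = d}

/-- A code of length `n` over the alphabet `A` (with at least two words, so that its minimum
distance makes sense) is an MDS symbol-pair code if it attains the Singleton bound
`|C| ≤ |A| ^ (n - d + 2)`. The minimum distance `d` is at most `n`, so that the subtraction
below is the one of the integers. -/
def IsMDSPairCode {A : Type*} {n : ℕ} (C : Set (Fin n → A)) : Prop :=
  C.Nontrivial ∧ Nat.card C = Nat.card A ^ (n + 2 - minPairDist C)

/-- The `lam`-constacyclic shift
`(x_0, x_1, …, x_{n-1}) ↦ (lam * x_{n-1}, x_0, …, x_{n-2})`. -/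
def constacyclicShift {R : Type*} [CommRing R] {n : ℕ} (lam : R) (x : Fin n → R) : Fin n → R :=
  fun i => if (i : ℕ) = 0 then lam * x ((finRotate n).symm i) else x ((finRotate n).symm i)

/-- A linear code is `lam`-constacyclic if the `lam`-constacyclic shift maps it onto itself. -/
def IsConstacyclic {R : Type*} [CommRing R] {n : ℕ} (lam : R)
    (C : Submodule R (Fin n → R)) : Prop :=
  constacyclicShift lam '' (C : Set (Fin n → R)) = (C : Set (Fin n → R))

/-- The quotient ring `R[x] / ⟨x ^ n - lam⟩`. -/
abbrev ConstaRing (R : Type*) [CommRing R] (n : ℕ) (lam : R) : Type _ :=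
  R[X] ⧸ Ideal.span {(X ^ n - C lam : R[X])}

/-- The residue class of a polynomial in `R[x] / ⟨x ^ n - lam⟩`. -/
noncomputable abbrev constaMk {R : Type*} [CommRing R] (n : ℕ) (lam : R) (f : R[X]) : ConstaRing R n lam :=
  Ideal.Quotient.mk (Ideal.span {(X ^ n - C lam : R[X])}) f

/-- The polynomial representation `c_0 + c_1 x + ⋯ + c_{n-1} x ^ (n-1)` of a vector. -/
noncomputable def polyRep {R : Type*} [CommRing R] {n : ℕ} (c : Fin n → R) : R[X] :=
  ∑ i : Fin n, C (c i) * X ^ (i : ℕ)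

/-- The linear code of length `n` given by an ideal of `R[x] / ⟨x ^ n - lam⟩`: the vectors whose
polynomial representation lies in the ideal. -/
noncomputable def codeOfIdeal {R : Type*} [CommRing R] {n : ℕ} {lam : R}
    (I : Ideal (ConstaRing R n lam)) : Submodule R (Fin n → R) where
  carrier := {c | constaMk n lam (polyRep c) ∈ I}
  zero_mem' := by simp [polyRep]
  add_mem' := by
    intro a b ha hb
    have h : polyRep (a + b) = polyRep a + polyRep b := by
      simp [polyRep, add_mul, Finset.sum_add_distrib]
    simp only [Set.mem_ofPred_eq, h, constaMk, map_add] at *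
    exact I.add_mem ha hb
  smul_mem' := by
    intro r a ha
    have h : polyRep (r • a) = C r * polyRep a := by
      simp [polyRep, Finset.mul_sum, mul_assoc]
    simp only [Set.mem_ofPred_eq, h, constaMk, map_mul] at *
    exact I.mul_mem_left _ ha

/-- The code given by the principal ideal `⟨f(x) + u g(x)⟩` of
`(K + uK)[x] / ⟨x ^ n - a⟩`, where `u ^ 2 = 0`, `a ∈ K` and `f, g ∈ K[x]`. The ring `K + uK` is
the ring of dual numbers over `K`, with `u = DualNumber.eps`. -/
noncomputable def pairCode {K : Type*} [Field K] (n : ℕ) (a : K) (f g : K[X]) :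
    Submodule (DualNumber K) (Fin n → DualNumber K) :=
  codeOfIdeal (lam := algebraMap K (DualNumber K) a)
    (Ideal.span {constaMk n (algebraMap K (DualNumber K) a)
      (f.map (algebraMap K (DualNumber K)) +
        C DualNumber.eps * g.map (algebraMap K (DualNumber K)))})

/-! Put `f = X ^ 2 - a₀` and `N = p ^ s`, so that `f ^ N = X ^ (2 * N) - a`. All three families have
the form `⟨f ^ j + u f ^ k b⟩` with `j < N` and `2 * j ≤ k + N`. That inequality makes the words
exactly the `r + u t` with `r = f ^ j * g` and `t ≡ g * f ^ k * b` mod `f ^ j` (`mem_pairCode_iff`),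
so there are `|R| ^ (2 * N - 2 * j)` of them (`natCard_pairCode`), and MDS means pair distance `2 *
j + 2`. The word `u f ^ j` has at most `j + 1` nonzero entries, hence pair weight at most `2 * j +
2`. Conversely, in a nonzero word either `r`, or `t` when `r = 0`, is a nonzero multiple of `f ^ j`.
Its even and odd parts are multiples of `(y - a₀) ^ j` in `y = X ^ 2`, and a nonzero one has more
than `j` terms (`HasWeightBound`). Positions of equal parity are never cyclically adjacent, so each
accounts for two pairs. The weight bound is proved for `j = 1`, for `j = N - 1`, and for every `j`
when `N = p`. -/

/-! ### Ideals give constacyclic codes. -/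

/-- A `lam`-constacyclic shift is multiplication by `X` modulo `X ^ n - lam`. -/
theorem polyRep_constacyclicShift {R : Type*} [CommRing R] {n : ℕ} (lam : R)
    (c : Fin (n + 1) → R) :
    polyRep (constacyclicShift lam c) =
      X * polyRep c - C (c (Fin.last n)) * (X ^ (n + 1) - C lam) := by
  have h0 : (finRotate (n + 1)).symm 0 = Fin.last n := by
    rw [Equiv.symm_apply_eq, finRotate_last]
  have h1 : ∀ i : Fin n, (finRotate (n + 1)).symm i.succ = i.castSucc := by
    intro i
    rw [Equiv.symm_apply_eq]
    ext
    rw [coe_finRotate_of_ne_last (Fin.castSucc_lt_last i).ne]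
    simp
  unfold polyRep
  rw [Fin.sum_univ_succ, Fin.sum_univ_castSucc]
  simp only [constacyclicShift, h0, h1, Fin.val_zero, Fin.val_succ, Fin.val_last,
    Fin.val_castSucc, if_true, Nat.succ_ne_zero, if_false, mul_add, Finset.mul_sum, C_mul]
  have : ∀ i : Fin n, C (c i.castSucc) * X ^ ((i : ℕ) + 1) =
      (X : R[X]) * (C (c i.castSucc) * X ^ (i : ℕ)) := fun i => by ring
  simp only [this]
  ring

theorem constaMk_polyRep_shift {R : Type*} [CommRing R] {n : ℕ} (lam : R)
    (c : Fin (n + 1) → R) :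
    constaMk (n + 1) lam (polyRep (constacyclicShift lam c)) =
      constaMk (n + 1) lam X * constaMk (n + 1) lam (polyRep c) := by
  rw [polyRep_constacyclicShift, constaMk, constaMk, constaMk, map_sub, map_mul, map_mul,
    Ideal.Quotient.eq_zero_iff_mem.2 (Ideal.mem_span_singleton_self (X ^ (n + 1) - C lam)),
    mul_zero, sub_zero]

/-- The power `X ^ (n + 1)` equals the unit `lam` in the quotient. Hence the shift both preserves
and reflects membership in an ideal. -/
theorem isUnit_constaMk_X {R : Type*} [CommRing R] {n : ℕ} {lam : R} (h : IsUnit lam) :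
    IsUnit (constaMk (n + 1) lam X) := by
  have h1 : constaMk (n + 1) lam X ^ (n + 1) = constaMk (n + 1) lam (C lam) := by
    rw [constaMk, ← map_pow, constaMk, Ideal.Quotient.mk_eq_mk_iff_sub_mem]
    exact Ideal.mem_span_singleton_self _
  rw [← isUnit_pow_iff (Nat.succ_ne_zero n), h1]
  exact (h.map C).map (Ideal.Quotient.mk _)

theorem constacyclicShift_surjective {R : Type*} [CommRing R] {n : ℕ} {lam : R} (h : IsUnit lam) :
    Function.Surjective (constacyclicShift (n := n) lam) := by
  intro y
  obtain ⟨v, hv⟩ := h.exists_right_inv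
  refine ⟨fun i => if (finRotate n i : ℕ) = 0 then v * y (finRotate n i)
    else y (finRotate n i), ?_⟩
  ext i
  by_cases hi : (i : ℕ) = 0
  · simp only [constacyclicShift, hi, if_true, Equiv.apply_symm_apply, ← mul_assoc, hv, one_mul]
  · simp only [constacyclicShift, hi, if_false, Equiv.apply_symm_apply]

theorem isConstacyclic_codeOfIdeal {R : Type*} [CommRing R] {n : ℕ} {lam : R} (hn : n ≠ 0)
    (h : IsUnit lam) (I : Ideal (ConstaRing R n lam)) : IsConstacyclic lam (codeOfIdeal I) := by
  obtain ⟨n, rfl⟩ := Nat.exists_eq_succ_of_ne_zero hn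
  have key : ∀ c, constacyclicShift lam c ∈ codeOfIdeal I ↔ c ∈ codeOfIdeal I := by
    intro c
    change constaMk (n + 1) lam (polyRep (constacyclicShift lam c)) ∈ I ↔
      constaMk (n + 1) lam (polyRep c) ∈ I
    rw [constaMk_polyRep_shift]
    exact Ideal.unit_mul_mem_iff_mem I (isUnit_constaMk_X h)
  ext y
  constructor
  · rintro ⟨x, hx, rfl⟩
    exact (key x).2 hx
  · intro hy
    obtain ⟨x, rfl⟩ := constacyclicShift_surjective h y
    exact ⟨x, (key x).1 hy, rfl⟩

/-! ### Hamming weights of multiples of `(X - a₀) ^ j` and of `(X ^ 2 - a₀) ^ j`. -/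

section Weight

variable {K : Type*} [Field K]

theorem one_lt_card_support_of_isRoot {a₀ : K} (ha₀ : a₀ ≠ 0) {g : K[X]} (hg : g ≠ 0)
    (hr : g.IsRoot a₀) : 1 < g.support.card := by
  by_contra! h
  obtain ⟨n, x, rfl⟩ := card_support_le_one_iff_monomial.1 h
  have hx : x ≠ 0 := by rintro rfl; simp at hg
  simp [IsRoot, ha₀, hx] at hr

/-- In characteristic `p`, a non-zero polynomial of degree less than `p` that is divisible by
`(X - a₀) ^ j` has more than `j` terms. -/
theorem lt_card_support_of_natDegree_lt_char {p : ℕ} [CharP K p] {a₀ : K} (ha₀ : a₀ ≠ 0)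
    (j : ℕ) {g : K[X]} (hg : g ≠ 0) (hdeg : g.natDegree < p) (hdvd : (X - C a₀) ^ j ∣ g) :
    j < g.support.card := by
  induction j generalizing g with
  | zero => exact Finset.card_pos.2 (nonempty_support_iff.2 hg)
  | succ j ih =>
    have hroot : g.IsRoot a₀ :=
      dvd_iff_isRoot.1 ((dvd_pow_self _ (Nat.succ_ne_zero j)).trans hdvd)
    have h1 := one_lt_card_support_of_isRoot ha₀ hg hroot
    set v := g.natDegree with hv
    -- The Euler operator minus `v` scales the `i`-th coefficient by `i - v`. As exponents below `p`
    -- stay distinct in `K`, it removes only the leading term, while the multiplicity of `a₀` drops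
    -- by at most one.
    set g₂ : K[X] := X * derivative g - C (v : K) * g with hg₂
    have hcoeff : ∀ i, g₂.coeff i = ((i : K) - v) * g.coeff i := by
      intro i
      rw [hg₂, coeff_sub, coeff_C_mul]
      cases i with
      | zero => simp
      | succ i => rw [coeff_X_mul, coeff_derivative]; push_cast; ring
    have hsupp : g₂.support = g.support.erase v := by
      ext i
      rw [mem_support_iff, hcoeff, Finset.mem_erase, mem_support_iff, mul_ne_zero_iff,
        and_congr_left_iff]
      intro hi
      have hiv : i ≤ v := le_natDegree_of_ne_zero hi
      rw [sub_ne_zero, not_iff_not]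
      constructor
      · intro h
        exact (CharP.natCast_injOn_Iio K p) (show i < p by omega) (show v < p by omega) h
      · rintro rfl; rfl
    have hvmem : v ∈ g.support := natDegree_mem_support_of_nonzero hg
    have hcard := Finset.card_erase_of_mem hvmem
    have hg₂0 : g₂ ≠ 0 := by
      rw [← nonempty_support_iff, hsupp, ← Finset.card_pos, hcard]
      omega
    have hdeg₂ : g₂.natDegree < p := by
      have : g₂.natDegree ∈ g₂.support := natDegree_mem_support_of_nonzero hg₂0
      rw [hsupp] at this
      exact (le_natDegree_of_mem_supp _ (Finset.mem_of_mem_erase this)).trans_lt hdeg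
    have hdvd₂ : (X - C a₀) ^ j ∣ g₂ := by
      refine dvd_sub (Dvd.dvd.mul_left ?_ _)
        (Dvd.dvd.mul_left ((pow_dvd_pow _ (Nat.le_succ j)).trans hdvd) _)
      simpa using pow_sub_one_dvd_derivative_of_pow_dvd hdvd
    have := ih hg₂0 hdeg₂ hdvd₂
    rw [hsupp, hcard] at this
    omega

/-- If `(X - a₀) ^ N = X ^ N - a₀ ^ N`, then a non-zero polynomial of degree less than `N` that is
divisible by `(X - a₀) ^ (N - 1)` has all of its `N` coefficients non-zero. -/
theorem card_support_of_pow_pred_dvd {N : ℕ} (hN : 0 < N) {a₀ : K} (ha₀ : a₀ ≠ 0)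
    (hpow : (X - C a₀) ^ N = X ^ N - C (a₀ ^ N)) {g : K[X]} (hg : g ≠ 0)
    (hdeg : g.natDegree < N) (hdvd : (X - C a₀) ^ (N - 1) ∣ g) :
    N - 1 < g.support.card := by
  obtain ⟨h, rfl⟩ := hdvd
  have hmon : ((X - C a₀) ^ (N - 1)).Monic := (monic_X_sub_C a₀).pow _
  have hh : h ≠ 0 := right_ne_zero_of_mul hg
  have hd : h.natDegree = 0 := by
    rw [hmon.natDegree_mul' hh, (monic_X_sub_C a₀).natDegree_pow, natDegree_X_sub_C] at hdeg
    omega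
  obtain ⟨c, rfl⟩ := natDegree_eq_zero.1 hd
  have hc : c ≠ 0 := by rintro rfl; simp at hh
  -- Dividing `X ^ N - a₀ ^ N` by `X - a₀` gives a geometric sum whose coefficients are powers of
  -- `a₀`.
  have hgeom : (X - C a₀) ^ (N - 1) =
      ∑ i ∈ Finset.range N, X ^ i * (C a₀) ^ (N - 1 - i) := by
    apply mul_left_cancel₀ (X_sub_C_ne_zero a₀)
    rw [← pow_succ', Nat.sub_add_cancel hN, hpow, mul_comm, geom_sum₂_mul, C_pow]
  have hsub : Finset.range N ⊆ ((X - C a₀) ^ (N - 1) * C c).support := by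
    intro l hl
    rw [mem_support_iff, coeff_mul_C, hgeom, finsetSum_coeff, Finset.sum_eq_single l]
    · rw [← C_pow, coeff_mul_C, coeff_X_pow, if_pos rfl, one_mul]
      exact mul_ne_zero (pow_ne_zero _ ha₀) hc
    · intro i _ hi
      rw [← C_pow, coeff_mul_C, coeff_X_pow, if_neg (Ne.symm hi), zero_mul]
    · exact fun h => (h hl).elim
  have := Finset.card_le_card hsub
  rw [Finset.card_range] at this
  omega

theorem exists_expand_two_add (h : K[X]) :
    ∃ h₀ h₁ : K[X], h = expand K 2 h₀ + X * expand K 2 h₁ := by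
  induction h using Polynomial.induction_on' with
  | add p q hp hq =>
    obtain ⟨p₀, p₁, rfl⟩ := hp
    obtain ⟨q₀, q₁, rfl⟩ := hq
    exact ⟨p₀ + q₀, p₁ + q₁, by simp only [map_add]; ring⟩
  | monomial n c =>
    obtain ⟨l, rfl | rfl⟩ := Nat.even_or_odd' n
    · exact ⟨monomial l c, 0, by simp [expand_monomial, mul_comm]⟩
    · exact ⟨0, monomial l c, by simp [expand_monomial, X_mul_monomial, mul_comm]⟩

theorem coeff_expand_two_add_even (h₀ h₁ : K[X]) (l : ℕ) :
    (expand K 2 h₀ + X * expand K 2 h₁).coeff (2 * l) = h₀.coeff l := by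
  rw [coeff_add, coeff_expand_mul' two_pos]
  cases l with
  | zero => simp
  | succ l =>
    rw [show 2 * (l + 1) = 2 * l + 1 + 1 by ring, coeff_X_mul, coeff_expand two_pos,
      if_neg (by omega), add_zero]

theorem coeff_expand_two_add_odd (h₀ h₁ : K[X]) (l : ℕ) :
    (expand K 2 h₀ + X * expand K 2 h₁).coeff (2 * l + 1) = h₁.coeff l := by
  rw [coeff_add, coeff_X_mul, coeff_expand_mul' two_pos, coeff_expand two_pos,
      if_neg (by omega), zero_add]

/-- The non-zero words of the repeated-root code `⟨(X - a₀) ^ j⟩` of length `N` all have more than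
`j` non-zero coordinates. -/
def HasWeightBound (a₀ : K) (N j : ℕ) : Prop :=
  ∀ g : K[X], g ≠ 0 → g.natDegree < N → (X - C a₀) ^ j ∣ g → j < g.support.card

/-- Since `(X ^ 2 - a₀) ^ j` is a polynomial in `X ^ 2`, multiplying by it respects the splitting
into even and odd parts. -/
theorem HasWeightBound.exists_parity {a₀ : K} {N j : ℕ} (hW : HasWeightBound a₀ N j)
    {g : K[X]} (hg : g ≠ 0) (hdeg : g.natDegree < 2 * N) (hdvd : (X ^ 2 - C a₀) ^ j ∣ g) :
    ∃ e : ℕ, ∃ T : Finset ℕ, j < T.card ∧ ∀ i ∈ T, i % 2 = e ∧ g.coeff i ≠ 0 := by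
  obtain ⟨h, rfl⟩ := hdvd
  obtain ⟨h₀, h₁, rfl⟩ := exists_expand_two_add h
  set q : K[X] := (X - C a₀) ^ j with hq
  have hf : (X ^ 2 - C a₀) ^ j = expand K 2 q := by simp [hq]
  have hsplit : (X ^ 2 - C a₀) ^ j * (expand K 2 h₀ + X * expand K 2 h₁) =
      expand K 2 (q * h₀) + X * expand K 2 (q * h₁) := by
    rw [hf]; simp only [map_mul]; ring
  rw [hsplit] at hg hdeg ⊢
  have hcoe := coeff_expand_two_add_even (q * h₀) (q * h₁)
  have hcoo := coeff_expand_two_add_odd (q * h₀) (q * h₁)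
  have hdeg' : ∀ r : K[X], r ≠ 0 → (∀ l, r.coeff l ≠ 0 → l < N) → r.natDegree < N :=
    fun r hr h => h _ (by simpa using hr)
  by_cases h0 : q * h₀ = 0
  · have h1 : q * h₁ ≠ 0 := by
      rintro h1; simp [h0, h1] at hg
    refine ⟨1, (q * h₁).support.image (fun l => 2 * l + 1), ?_, ?_⟩
    · rw [Finset.card_image_of_injective _ (fun x y h => by simpa using h)]
      refine hW _ h1 (hdeg' _ h1 fun l hl => ?_) (dvd_mul_right _ _)
      rw [← hcoo] at hl
      have := le_natDegree_of_ne_zero hl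
      omega
    · intro i hi
      obtain ⟨l, hl, rfl⟩ := Finset.mem_image.1 hi
      exact ⟨by omega, by rw [hcoo]; exact mem_support_iff.1 hl⟩
  · refine ⟨0, (q * h₀).support.image (fun l => 2 * l), ?_, ?_⟩
    · rw [Finset.card_image_of_injective _ (fun x y h => by simpa using h)]
      refine hW _ h0 (hdeg' _ h0 fun l hl => ?_) (dvd_mul_right _ _)
      rw [← hcoe] at hl
      have := le_natDegree_of_ne_zero hl
      omega
    · intro i hi
      obtain ⟨l, hl, rfl⟩ := Finset.mem_image.1 hi
      exact ⟨by omega, by rw [hcoe]; exact mem_support_iff.1 hl⟩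

end Weight

/-! ### Pair weight versus Hamming weight. -/

section PairDistance

/-- The wrap-around from `2 * N - 1` to `0` also flips parity because the length is even. -/
theorem val_finRotate_mod_two {N : ℕ} (i : Fin (2 * N)) :
    (finRotate (2 * N) i : ℕ) % 2 = ((i : ℕ) + 1) % 2 := by
  obtain ⟨n, hn⟩ : ∃ n, 2 * N = n + 1 := ⟨2 * N - 1, by have := i.2; omega⟩
  revert i
  rw [hn]
  intro i
  rw [coe_finRotate]
  split_ifs with h
  · subst h; simp; omega
  · rfl

theorem pairDist_sub {A : Type*} [AddGroup A] {n : ℕ} (x y : Fin n → A) :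
    pairDist x y = pairDist (x - y) 0 := by
  simp [pairDist, Prod.ext_iff, sub_eq_zero]

theorem pairDist_zero_eq {A : Type*} [Zero A] {n : ℕ} (x : Fin n → A) :
    pairDist x 0 = ({i | x i ≠ 0} ∪ (finRotate n).symm '' {i | x i ≠ 0}).ncard := by
  unfold pairDist
  congr 1
  ext i
  rw [Equiv.image_symm_eq_preimage]
  simp only [Set.mem_ofPred_eq, Set.mem_union, Set.mem_preimage, ne_eq, Prod.ext_iff,
    Pi.zero_apply, not_and_or]

theorem pairDist_zero_le {A : Type*} [Zero A] {n : ℕ} (x : Fin n → A) :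
    pairDist x 0 ≤ 2 * {i | x i ≠ 0}.ncard := by
  rw [pairDist_zero_eq, two_mul]
  refine (Set.ncard_union_le _ _).trans ?_
  rw [Set.ncard_image_of_injective _ (Equiv.injective _)]

theorem two_mul_ncard_le_pairDist {A : Type*} [Zero A] {N : ℕ} (x : Fin (2 * N) → A) (e : ℕ) :
    2 * {i : Fin (2 * N) | (i : ℕ) % 2 = e ∧ x i ≠ 0}.ncard ≤ pairDist x 0 := by
  set S := {i : Fin (2 * N) | (i : ℕ) % 2 = e ∧ x i ≠ 0} with hS
  have hdisj : Disjoint S ((finRotate (2 * N)).symm '' S) := by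
    rw [Set.disjoint_left]
    rintro i hi ⟨l, hl, rfl⟩
    have := val_finRotate_mod_two ((finRotate (2 * N)).symm l)
    rw [Equiv.apply_symm_apply] at this
    have h1 := hi.1
    have h2 := hl.1
    omega
  have hsub : S ⊆ {i | x i ≠ 0} := fun i hi => hi.2
  calc 2 * S.ncard = (S ∪ (finRotate (2 * N)).symm '' S).ncard := by
        rw [Set.ncard_union_eq hdisj, Set.ncard_image_of_injective _ (Equiv.injective _), two_mul]
    _ ≤ _ := by
        rw [pairDist_zero_eq]
        exact Set.ncard_le_ncard (Set.union_subset_union hsub (Set.image_mono hsub))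

end PairDistance

/-! ### Words and cardinality of `⟨F + u G⟩`. -/

section DualNumberCodes

variable {K : Type*} [Field K]

/-- The vector of length `n` over the dual numbers whose two components have the coefficients of
`r` and `t`. -/
noncomputable def dualVec (n : ℕ) (r t : K[X]) : Fin n → DualNumber K :=
  fun i => TrivSqZeroExt.inl (r.coeff i) + TrivSqZeroExt.inr (t.coeff i)

/-- The polynomial over `K` of the components of `c` without `u`. -/
noncomputable def resPoly {n : ℕ} (c : Fin n → DualNumber K) : K[X] :=
  ∑ i : Fin n, C (c i).fst * X ^ (i : ℕ)

/-- The polynomial over `K` of the coefficients of `u` in the components of `c`. -/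
noncomputable def epsPoly {n : ℕ} (c : Fin n → DualNumber K) : K[X] :=
  ∑ i : Fin n, C (c i).snd * X ^ (i : ℕ)

theorem coeff_sum_fin {n : ℕ} (w : Fin n → K) (i : Fin n) :
    (∑ l : Fin n, C (w l) * X ^ (l : ℕ) : K[X]).coeff i = w i := by
  rw [finsetSum_coeff, Finset.sum_eq_single i]
  · simp
  · intro l _ hl
    rw [coeff_C_mul, coeff_X_pow, if_neg (fun h => hl (Fin.ext h.symm)), mul_zero]
  · simp

theorem sum_fin_mem_degreeLT {n : ℕ} (w : Fin n → K) :
    (∑ l : Fin n, C (w l) * X ^ (l : ℕ) : K[X]) ∈ degreeLT K n := by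
  refine Submodule.sum_mem _ fun l _ => mem_degreeLT.2 ?_
  exact (degree_C_mul_X_pow_le _ _).trans_lt (by exact_mod_cast l.2)

theorem sum_fin_coeff {n : ℕ} {r : K[X]} (hr : r ∈ degreeLT K n) :
    (∑ l : Fin n, C (r.coeff l) * X ^ (l : ℕ) : K[X]) = r := by
  ext i
  by_cases hi : i < n
  · exact coeff_sum_fin (fun l => r.coeff l) ⟨i, hi⟩
  · rw [mem_degreeLT, degree_lt_iff_coeff_zero] at hr
    have h := mem_degreeLT.1 (sum_fin_mem_degreeLT (fun l : Fin n => r.coeff l))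
    rw [degree_lt_iff_coeff_zero] at h
    rw [hr i (not_lt.1 hi), h i (not_lt.1 hi)]

theorem resPoly_dualVec {n : ℕ} {r : K[X]} (t : K[X]) (hr : r ∈ degreeLT K n) :
    resPoly (dualVec n r t) = r := by
  simpa [resPoly, dualVec] using sum_fin_coeff hr

theorem epsPoly_dualVec {n : ℕ} {t : K[X]} (r : K[X]) (ht : t ∈ degreeLT K n) :
    epsPoly (dualVec n r t) = t := by
  simpa [epsPoly, dualVec] using sum_fin_coeff ht

theorem dualVec_resPoly_epsPoly {n : ℕ} (c : Fin n → DualNumber K) :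
    dualVec n (resPoly c) (epsPoly c) = c := by
  ext i
  · simpa [dualVec, resPoly] using coeff_sum_fin (fun l => (c l).fst) i
  · simpa [dualVec, epsPoly] using coeff_sum_fin (fun l => (c l).snd) i

theorem polyRep_eq {n : ℕ} (c : Fin n → DualNumber K) :
    polyRep c = (resPoly c).map (algebraMap K (DualNumber K)) +
      C DualNumber.eps * (epsPoly c).map (algebraMap K (DualNumber K)) := by
  simp only [polyRep, resPoly, epsPoly, Polynomial.map_sum, Finset.mul_sum,
    ← Finset.sum_add_distrib]
  refine Finset.sum_congr rfl fun i _ => ?_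
  simp only [Polynomial.map_mul, map_C, Polynomial.map_pow, map_X, ← mul_assoc, ← C_mul, ← add_mul,
    ← C_add]
  congr 2
  ext <;> simp [TrivSqZeroExt.algebraMap_eq_inl]

/-- The isomorphism of `K[u][X]` and `K[X][u]` as a ring homomorphism. -/
noncomputable def polyDual (K : Type*) [Field K] : (DualNumber K)[X] →+* DualNumber K[X] :=
  eval₂RingHom
    (DualNumber.lift (R := K) (A := K) (B := DualNumber K[X])
      ⟨(Algebra.ofId K _, DualNumber.eps),
        ⟨DualNumber.eps_mul_eps, fun _ => Commute.all _ _⟩⟩ : DualNumber K →+* DualNumber K[X])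
    (TrivSqZeroExt.inl X)

theorem polyDual_map (g : K[X]) :
    polyDual K (g.map (algebraMap K (DualNumber K))) = TrivSqZeroExt.inl g := by
  have : (polyDual K).comp (mapRingHom (algebraMap K (DualNumber K))) =
      TrivSqZeroExt.inlHom K[X] K[X] := by
    ext x
    · simp [polyDual, TrivSqZeroExt.algebraMap_eq_inl', Algebra.ofId_apply]
    · simp [polyDual, TrivSqZeroExt.algebraMap_eq_inl', Algebra.ofId_apply]
    · simp [polyDual]
    · simp [polyDual]
  exact RingHom.congr_fun this g

theorem polyDual_eps : polyDual K (C DualNumber.eps) = DualNumber.eps := by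
  simp [polyDual]

/-- Membership in `⟨F + u G⟩` in terms of the residue and the `u`-part of a word. -/
theorem mem_pairCode_iff {n : ℕ} {a : K} {F G H : K[X]} (hFH : F * H = X ^ n - C a)
    (hGH : F ∣ H * G) (c : Fin n → DualNumber K) :
    c ∈ pairCode n a F G ↔ ∃ g, resPoly c = F * g ∧ F ∣ epsPoly c - g * G := by
  set ι := algebraMap K (DualNumber K) with hι
  have hmem : c ∈ pairCode n a F G ↔
      polyRep c ∈ Ideal.span {F.map ι + C DualNumber.eps * G.map ι} ⊔
        Ideal.span {X ^ n - C (ι a)} := by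
    change constaMk n (ι a) (polyRep c) ∈ Ideal.span {constaMk n (ι a) _} ↔ _
    rw [← Ideal.mem_quotient_iff_mem_sup, Ideal.map_span, Set.image_singleton]
  rw [hmem, Ideal.mem_span_singleton_sup]
  constructor
  · rintro ⟨A, B, hB, hAB⟩
    obtain ⟨B, rfl⟩ := Ideal.mem_span_singleton'.1 hB
    have hX : X ^ n - C (ι a) = (F * H).map ι := by rw [hFH]; simp
    -- In `K[X][u]` the two components of the identity can be compared separately.
    have h := congrArg (polyDual K) hAB
    rw [hX, polyRep_eq] at h
    have hmap : ∀ g : K[X], polyDual K (g.map ι) = TrivSqZeroExt.inl g := polyDual_map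
    simp only [map_add, map_mul, ← hι, hmap, polyDual_eps] at h
    have h1 := congrArg TrivSqZeroExt.fst h
    have h2 := congrArg TrivSqZeroExt.snd h
    simp at h1 h2
    obtain ⟨q, hq⟩ := hGH
    -- The multiple of `X ^ n - a = F * H` adds `B₀ * H` to `g`; the resulting term `B₀ * H * G` is
    -- absorbed because `F ∣ H * G`.
    refine ⟨(polyDual K A).fst + (polyDual K B).fst * H, ?_, ?_⟩
    · rw [← h1]; ring
    · rw [← h2]
      refine ⟨(polyDual K A).snd + H * (polyDual K B).snd - (polyDual K B).fst * q, ?_⟩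
      linear_combination (-(polyDual K B).fst) * hq
  · rintro ⟨g, hg, h, hh⟩
    refine ⟨g.map ι + C DualNumber.eps * h.map ι, 0, zero_mem _, ?_⟩
    have hε : (C DualNumber.eps * C DualNumber.eps : (DualNumber K)[X]) = 0 := by
      rw [← C_mul, DualNumber.eps_mul_eps, C_0]
    rw [polyRep_eq, hg, sub_eq_iff_eq_add.1 hh]
    simp only [Polynomial.map_add, Polynomial.map_mul]
    linear_combination (h.map ι * G.map ι) * hε

theorem natCard_degreeLT (d : ℕ) : Nat.card (degreeLT K d) = Nat.card K ^ d := by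
  rw [Nat.card_congr (degreeLTEquiv K d).toEquiv, Nat.card_fun, Nat.card_fin]

theorem mul_mem_degreeLT {F g : K[X]} {d n : ℕ} (hF : F.Monic) (hFn : F.natDegree + d = n)
    (hg : g ∈ degreeLT K d) : F * g ∈ degreeLT K n := by
  by_cases h0 : g = 0
  · simp [h0]
  rw [mem_degreeLT, degree_eq_natDegree (hF.mul_right_ne_zero h0), hF.natDegree_mul' h0]
  rw [mem_degreeLT, degree_eq_natDegree h0] at hg
  norm_cast at *
  omega

theorem mem_degreeLT_of_mul {F g : K[X]} {d n : ℕ} (hF : F.Monic) (hFn : F.natDegree + d = n)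
    (hg : F * g ∈ degreeLT K n) : g ∈ degreeLT K d := by
  by_cases h0 : g = 0
  · simp [h0]
  rw [mem_degreeLT, degree_eq_natDegree (hF.mul_right_ne_zero h0), hF.natDegree_mul' h0] at hg
  rw [mem_degreeLT, degree_eq_natDegree h0]
  norm_cast at *
  omega

/-- A word amounts to a free pair `(g, h)` of polynomials of degree below `d`: its components are `F
* g` and `(g * G) %ₘ F + F * h`, the remainder keeping the degree below `n`. -/
theorem natCard_pairCode {n d : ℕ} {a : K} {F G H : K[X]} (hF : F.Monic)
    (hFn : F.natDegree + d = n) (hFH : F * H = X ^ n - C a) (hGH : F ∣ H * G) :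
    Nat.card (pairCode n a F G : Set (Fin n → DualNumber K)) = Nat.card (DualNumber K) ^ d := by
  have hmod : ∀ g : K[X], (g * G) %ₘ F ∈ degreeLT K n := by
    intro g
    rw [mem_degreeLT]
    refine (degree_modByMonic_lt _ hF).trans_le (degree_le_natDegree.trans ?_)
    exact_mod_cast (by omega : F.natDegree ≤ n)
  have hr : ∀ g : degreeLT K d, F * (g : K[X]) ∈ degreeLT K n :=
    fun g => mul_mem_degreeLT hF hFn g.2
  have ht : ∀ g h : degreeLT K d, ((g : K[X]) * G) %ₘ F + F * (h : K[X]) ∈ degreeLT K n :=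
    fun g h => add_mem (hmod _) (hr h)
  let Ψ : degreeLT K d × degreeLT K d → (pairCode n a F G : Set (Fin n → DualNumber K)) :=
    fun x => ⟨dualVec n (F * (x.1 : K[X])) (((x.1 : K[X]) * G) %ₘ F + F * (x.2 : K[X])), by
      refine (mem_pairCode_iff hFH hGH _).2 ⟨x.1, resPoly_dualVec _ (hr _), ?_⟩
      rw [epsPoly_dualVec _ (ht _ _)]
      refine ⟨(x.2 : K[X]) - ((x.1 : K[X]) * G) /ₘ F, ?_⟩
      linear_combination modByMonic_add_div ((x.1 : K[X]) * G) F⟩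
  have hΨ : Function.Bijective Ψ := by
    constructor
    · rintro ⟨g, h⟩ ⟨g', h'⟩ heq
      have heq := congrArg Subtype.val heq
      have h1 := congrArg resPoly heq
      have h2 := congrArg epsPoly heq
      simp only [Ψ] at h1 h2
      rw [resPoly_dualVec _ (hr _), resPoly_dualVec _ (hr _)] at h1
      rw [epsPoly_dualVec _ (ht _ _), epsPoly_dualVec _ (ht _ _)] at h2
      have hg : g = g' := Subtype.ext (mul_left_cancel₀ hF.ne_zero h1)
      subst hg
      have hh : h = h' := Subtype.ext (mul_left_cancel₀ hF.ne_zero (add_left_cancel h2))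
      rw [hh]
    · rintro ⟨c, hc⟩
      obtain ⟨g, hg, q, hq⟩ := (mem_pairCode_iff hFH hGH c).1 hc
      have hgd : g ∈ degreeLT K d :=
        mem_degreeLT_of_mul hF hFn (hg ▸ sum_fin_mem_degreeLT _)
      have hsum : epsPoly c = (g * G) %ₘ F + F * (q + (g * G) /ₘ F) := by
        linear_combination hq - modByMonic_add_div (g * G) F
      have hqd : q + (g * G) /ₘ F ∈ degreeLT K d := by
        refine mem_degreeLT_of_mul hF hFn ?_
        rw [← sub_eq_iff_eq_add'.2 hsum]
        exact sub_mem (sum_fin_mem_degreeLT _) (hmod g)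
      refine ⟨(⟨g, hgd⟩, ⟨_, hqd⟩), Subtype.ext ?_⟩
      simp only [Ψ]
      rw [← hg, ← hsum, dualVec_resPoly_epsPoly]
  have hcard : Nat.card (DualNumber K) = Nat.card K * Nat.card K := Nat.card_prod K K
  rw [← Nat.card_congr (Equiv.ofBijective Ψ hΨ), Nat.card_prod, natCard_degreeLT, hcard, mul_pow]

end DualNumberCodes

/-! ### The pair distance and the Singleton bound. -/

section MDS

variable {K : Type*} [Field K]

theorem le_pairDist_of_hasWeightBound {a₀ : K} {N j : ℕ} (hW : HasWeightBound a₀ N j)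
    {g : K[X]} (hg : g ≠ 0) (hdeg : g ∈ degreeLT K (2 * N)) (hdvd : (X ^ 2 - C a₀) ^ j ∣ g)
    (c : Fin (2 * N) → DualNumber K) (hc : ∀ i : Fin (2 * N), g.coeff i ≠ 0 → c i ≠ 0) :
    2 * j + 2 ≤ pairDist c 0 := by
  rw [mem_degreeLT, ← natDegree_lt_iff_degree_lt hg] at hdeg
  obtain ⟨e, T, hT, hTe⟩ := hW.exists_parity hg hdeg hdvd
  have hsub : (T : Set ℕ) ⊆
      Fin.val '' {i : Fin (2 * N) | (i : ℕ) % 2 = e ∧ c i ≠ 0} := by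
    intro i hi
    obtain ⟨h1, h2⟩ := hTe i hi
    exact ⟨⟨i, (le_natDegree_of_ne_zero h2).trans_lt hdeg⟩, ⟨h1, hc _ h2⟩, rfl⟩
  have h1 := Set.ncard_le_ncard hsub
  rw [Set.ncard_coe_finset, Set.ncard_image_of_injective _ Fin.val_injective] at h1
  have := two_mul_ncard_le_pairDist c e
  omega

theorem ncard_support_le {N j : ℕ} (a₀ : K) :
    {i : Fin (2 * N) | dualVec (2 * N) 0 ((X ^ 2 - C a₀) ^ j) i ≠ 0}.ncard ≤ j + 1 := by
  have hf : (X ^ 2 - C a₀) ^ j = expand K 2 ((X - C a₀) ^ j) := by simp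
  rw [← Set.ncard_image_of_injective _ Fin.val_injective]
  refine (Set.ncard_le_ncard (t := ((Finset.range (j + 1)).image (fun l => 2 * l) : Finset ℕ))
    ?_).trans ?_
  · rintro _ ⟨i, hi, rfl⟩
    have hi : ((X ^ 2 - C a₀) ^ j).coeff (i : ℕ) ≠ 0 := fun h => hi (by simp [dualVec, h])
    rw [hf, coeff_expand two_pos] at hi
    split_ifs at hi with h2
    · have := le_natDegree_of_ne_zero hi
      rw [(monic_X_sub_C a₀).natDegree_pow, natDegree_X_sub_C] at this
      exact Finset.mem_coe.2 (Finset.mem_image.2 ⟨i / 2, Finset.mem_range.2 (by omega), by omega⟩)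
    · exact (hi rfl).elim
  · rw [Set.ncard_coe_finset]
    exact Finset.card_image_le.trans (by simp)

theorem isMDSPairCode_pairCode {a₀ a : K} {N j k : ℕ} (hj : j < N) (hk : 2 * j ≤ k + N)
    (hpow : (X - C a₀) ^ N = X ^ N - C a) (hW : HasWeightBound a₀ N j) (b : K[X]) :
    IsMDSPairCode (pairCode (2 * N) a ((X ^ 2 - C a₀) ^ j) ((X ^ 2 - C a₀) ^ k * b) :
      Set (Fin (2 * N) → DualNumber K)) := by
  set f : K[X] := X ^ 2 - C a₀ with hf
  have hfm : f.Monic := monic_X_pow_sub_C a₀ two_ne_zero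
  have hFm : (f ^ j).Monic := hfm.pow j
  have hFd : (f ^ j).natDegree = 2 * j := by
    rw [hfm.natDegree_pow, hf, natDegree_X_pow_sub_C, mul_comm]
  have hFH : f ^ j * f ^ (N - j) = X ^ (2 * N) - C a := by
    rw [← pow_add, Nat.add_sub_cancel' hj.le]
    have := congrArg (expand K 2) hpow
    simpa [← pow_mul] using this
  -- This is where `2 * j ≤ k + N` enters: the exponent `N - j + k` is at least `j`.
  have hGH : f ^ j ∣ f ^ (N - j) * (f ^ k * b) := by
    rw [← mul_assoc, ← pow_add]
    exact (pow_dvd_pow f (by omega)).mul_right b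
  have hmem := mem_pairCode_iff hFH hGH
  set D := pairCode (2 * N) a (f ^ j) (f ^ k * b) with hD
  have hfdeg : f ^ j ∈ degreeLT K (2 * N) := by
    rw [mem_degreeLT, ← natDegree_lt_iff_degree_lt hFm.ne_zero, hFd]
    omega
  set w := dualVec (2 * N) 0 (f ^ j) with hw
  have hwr : resPoly w = 0 := resPoly_dualVec _ (zero_mem _)
  have hwe : epsPoly w = f ^ j := epsPoly_dualVec _ hfdeg
  have hwD : w ∈ D := (hmem w).2 ⟨0, by simp [hwr], by simp [hwe]⟩
  have hw0 : w ≠ 0 := by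
    intro h
    apply hFm.ne_zero
    rw [← hwe, h]
    simp [epsPoly]
  have hlow : ∀ c ∈ D, c ≠ 0 → 2 * j + 2 ≤ pairDist c 0 := by
    intro c hc hc0
    obtain ⟨g, hg, hgd⟩ := (hmem c).1 hc
    by_cases hr : resPoly c = 0
    · have hg0 : g = 0 := by
        rw [hr] at hg
        exact (mul_eq_zero.1 hg.symm).resolve_left hFm.ne_zero
      rw [hg0, zero_mul, sub_zero] at hgd
      have he : epsPoly c ≠ 0 := by
        intro he
        apply hc0
        rw [← dualVec_resPoly_epsPoly c, hr, he]
        ext <;> simp [dualVec]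
      refine le_pairDist_of_hasWeightBound hW he (sum_fin_mem_degreeLT _) hgd c fun i hi h => hi ?_
      rw [epsPoly, coeff_sum_fin (fun l => (c l).snd), h, TrivSqZeroExt.snd_zero]
    · refine le_pairDist_of_hasWeightBound hW hr (sum_fin_mem_degreeLT _)
        (hg ▸ dvd_mul_right _ _) c fun i hi h => hi ?_
      rw [resPoly, coeff_sum_fin (fun l => (c l).fst), h, TrivSqZeroExt.fst_zero]
  have hup : pairDist w 0 ≤ 2 * j + 2 := by
    have h1 := pairDist_zero_le w
    have h2 : {i | w i ≠ 0}.ncard ≤ j + 1 := ncard_support_le a₀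
    omega
  have hdist : minPairDist (D : Set (Fin (2 * N) → DualNumber K)) = 2 * j + 2 := by
    have hm : 2 * j + 2 ∈ {d : ℕ | ∃ x ∈ (D : Set (Fin (2 * N) → DualNumber K)),
        ∃ y ∈ (D : Set (Fin (2 * N) → DualNumber K)), x ≠ y ∧ pairDist x y = d} :=
      ⟨w, hwD, 0, D.zero_mem, hw0, le_antisymm hup (hlow w hwD hw0)⟩
    refine le_antisymm (Nat.sInf_le hm) (le_csInf ⟨_, hm⟩ ?_)
    rintro d ⟨x, hx, y, hy, hxy, rfl⟩
    rw [pairDist_sub]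
    exact hlow _ (D.sub_mem hx hy) (sub_ne_zero.2 hxy)
  refine ⟨⟨w, hwD, 0, D.zero_mem, hw0⟩, ?_⟩
  rw [hdist, natCard_pairCode (d := 2 * N - 2 * j) hFm (by omega) hFH hGH]
  congr 1
  omega

end MDS

/-! ### The three families. -/

theorem mainTheorem3 (p m s : ℕ) (hp : p.Prime) (hs : 1 ≤ s)
    (K : Type*) [Field K] (hK : Nat.card K = p ^ m)
    (a₀ : K) (ha₀ : a₀ ≠ 0) (a : K) (ha : a = a₀ ^ p ^ s)
    (b : K[X])
    (hb : constaMk (2 * p ^ s) a b = 0 ∨ IsUnit (constaMk (2 * p ^ s) a b)) :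
    (IsConstacyclic (algebraMap K (DualNumber K) a)
        (pairCode (2 * p ^ s) a (X ^ 2 - C a₀) b) ∧
      IsMDSPairCode
        (pairCode (2 * p ^ s) a (X ^ 2 - C a₀) b : Set (Fin (2 * p ^ s) → DualNumber K))) ∧
    (IsConstacyclic (algebraMap K (DualNumber K) a)
        (pairCode (2 * p ^ s) a ((X ^ 2 - C a₀) ^ (p ^ s - 1))
          ((X ^ 2 - C a₀) ^ (p ^ s - 2) * b)) ∧
      IsMDSPairCode
        (pairCode (2 * p ^ s) a ((X ^ 2 - C a₀) ^ (p ^ s - 1))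
          ((X ^ 2 - C a₀) ^ (p ^ s - 2) * b) : Set (Fin (2 * p ^ s) → DualNumber K))) ∧
    (s = 1 → ∀ j k : ℕ, 1 ≤ j → j ≤ p - 1 → max 0 (2 * (j : ℤ) - p) ≤ k → k < j →
      IsConstacyclic (algebraMap K (DualNumber K) a)
        (pairCode (2 * p ^ s) a ((X ^ 2 - C a₀) ^ j) ((X ^ 2 - C a₀) ^ k * b)) ∧
      IsMDSPairCode
        (pairCode (2 * p ^ s) a ((X ^ 2 - C a₀) ^ j) ((X ^ 2 - C a₀) ^ k * b) :
          Set (Fin (2 * p ^ s) → DualNumber K))) := by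
  have : Fact p.Prime := ⟨hp⟩
  have : Finite K := Nat.finite_of_card_ne_zero (hK ▸ pow_ne_zero m hp.ne_zero)
  have := Fintype.ofFinite K
  rw [Nat.card_eq_fintype_card] at hK
  have : CharP K p := charP_of_card_eq_prime_pow hK
  have hN : 2 ≤ p ^ s := hp.two_le.trans (Nat.le_self_pow (by omega) p)
  have hpow : (X - C a₀) ^ p ^ s = X ^ p ^ s - C a := by
    rw [sub_pow_char_pow, ha, C_pow]
  have hcyc : ∀ F G : K[X], IsConstacyclic (algebraMap K (DualNumber K) a)
      (pairCode (2 * p ^ s) a F G) := fun F G =>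
    isConstacyclic_codeOfIdeal (by omega)
      ((IsUnit.mk0 a (ha ▸ pow_ne_zero _ ha₀)).map (algebraMap K (DualNumber K))) _
  refine ⟨⟨hcyc _ _, ?_⟩, ⟨hcyc _ _, ?_⟩, fun hs1 j k _ hjp hjk _ => ⟨hcyc _ _, ?_⟩⟩
  · have hW : HasWeightBound a₀ (p ^ s) 1 := fun g hg _ hdvd =>
      one_lt_card_support_of_isRoot ha₀ hg (dvd_iff_isRoot.1 (by simpa using hdvd))
    simpa using isMDSPairCode_pairCode (k := 0) (by omega) (by omega) hpow hW b
  -- Here `2 * j = k + N` exactly, with `j = N - 1` and `k = N - 2`.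
  · exact isMDSPairCode_pairCode (by omega) (by omega) hpow
      (fun g hg hdeg hdvd => card_support_of_pow_pred_dvd (by omega) ha₀ (ha ▸ hpow) hg hdeg hdvd) b
  · have hps : p ^ s = p := by rw [hs1, pow_one]
    have hp1 := hp.one_lt
    have h2 := (le_max_right _ _).trans hjk
    refine isMDSPairCode_pairCode (by omega) (by omega) hpow (fun g hg hdeg hdvd => ?_) b
    exact lt_card_support_of_natDegree_lt_char (p := p) ha₀ j hg (hps ▸ hdeg) hdvd
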